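/- **Setting.** Subscripts $\xi$, $x$ denote weak derivatives on $\mathbb R$, and functions in $H^1(\mathbb R)$, $V$ below are identified with their continuous representatives. Let $V=\{f\in C(\mathbb R)\cap L^\infty(\mathbb R)\mid f_\xi\in L^2(\mathbb R)\}$ with $\|f\|_V=\|f\|_{L^\infty}+\|f_\xi\|_{L^2}$, and $E=V\times H^1(\mathbb R)\times V$ with $\|(\zeta,U,H)\|=\|\zeta\|_V+\|U\|_{H^1}+\|H\|_V$. A triple $X=(y,U,H)$ is identified with $(\zeta,U,H)$, where $\zeta(\xi)=y(\xi)-\xi$; in particular $\|X-\tilde X\|$ is the norm of $(\zeta-\tilde\zeta,U-\tilde U,H-\tilde H)$. Let $\mathcal G$ be the set of all $X=(y,U,H)$ with $(\zeta,U,H)\in E\cap[W^{1,\infty}(\mathbb R)]^3$ such that $y_\xi\ge0$, $H_\xi\ge 0$, $y_\xi+H_\xi>0$ and $y_\xi H_\xi=y_\xi^2U^2+U_\xi^2$ almost everywhere, and $\lim_{\xi\to-\infty}H(\xi)=0$. Let $G$ be the group of homeomorphisms $f$ of $\mathbb R$ such that $f-\mathrm{id}$ and $f^{-1}-\mathrm{id}$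 belong to $W^{1,\infty}(\mathbb R)$ and $f_\xi-1\in L^2(\mathbb R)$. For $\kappa\ge 0$ let $G_\kappa$ be the set of $f\in G$ with $\|f-\mathrm{id}\|_{W^{1,\infty}}+\|f^{-1}-\mathrm{id}\|_{W^{1,\infty}}\le\kappa$, and let $\mathcal F_0=\{(y,U,H)\in\mathcal G\mid y+H\in G_0\}$, where $G_0=\{\mathrm{id}\}$. Write $X\circ f=(y\circ f,U\circ f,H\circ f)$ and set $$J(X,\tilde X)=\inf_{f_1,f_2\in G}\big(\|X\circ f_1-\tilde X\|+\|X-\tilde X\circ f_2\|\big),\qquad d(X,\tilde X)=\inf\sum_{n=1}^N J(X_{n-1},X_n),$$ the last infimum being over all finite sequences $X_0,\dots,X_N$ in $\mathcal F_0$ with $X_0=X$ and $X_N=\tilde X$. Let $\mathcal D$ be the set of pairs $(u,\mu)$ where $u\in H^1(\mathbb R)$ and $\mu$ is a finite positive Radon measure on $\mathbb R$ whose absolutely continuous part is $(u^2+u_x^2)\,dx$. For $(u,\mu)\in\mathcal D$ let $L(u,\mu)=(y,U,H)\in\mathcal F_0$ be given by $$y(\xi)=\sup\{y\mid \mu((-\infty,y))+y<\xi\},\qquad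 H(\xi)=\xi-y(\xi),\qquad U(\xi)=u(y(\xi)),$$ and let $d_{\mathcal D}((u,\mu),(\tilde u,\tilde\mu))=d(L(u,\mu),L(\tilde u,\tilde\mu))$. **Proposition.** Let $(u_n,\mu_n)$ be a sequence in $\mathcal D$ and let $(u,\mu)\in\mathcal D$ be such that $d_{\mathcal D}((u_n,\mu_n),(u,\mu))\to0$. Then $u_n\to u$ uniformly on $\mathbb R$ (equivalently, in $L^\infty(\mathbb R)$), and $\mu_n$ converges weakly-star to $\mu$, that is, $\int\varphi\,d\mu_n\to\int\varphi\,d\mu$ for every continuous $\varphi\colon\mathbb R\to\mathbb R$ vanishing at infinity. -/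

import Mathlib

open MeasureTheory Filter Topology
open scoped ENNReal ZeroAtInfty

noncomputable section

namespace CamassaHolm

/-- `g` is a weak derivative of `f` on `ℝ`: both are locally integrable, and
`∫ f φ' = - ∫ g φ` for every smooth compactly supported test function `φ`. -/
def HasWeakDeriv (f g : ℝ → ℝ) : Prop :=
  LocallyIntegrable f volume ∧ LocallyIntegrable g volume ∧
    ∀ φ : ℝ → ℝ, ContDiff ℝ (⊤ : ℕ∞) φ → HasCompactSupport φ →
      ∫ x, f x * deriv φ x = - ∫ x, g x * φ x

/-- Weak derivatives are unique up to null sets. -/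
theorem HasWeakDeriv.ae_eq {f g h : ℝ → ℝ} (hg : HasWeakDeriv f g) (hh : HasWeakDeriv f h) :
    g =ᵐ[volume] h := by
  have key : ∀ᵐ x ∂(volume : Measure ℝ), (g - h) x = 0 := by
    refine ae_eq_zero_of_integral_contDiff_smul_eq_zero (hg.2.1.sub hh.2.1) ?_
    intro φ hφ hc
    have e1 := hg.2.2 φ hφ hc
    have e2 := hh.2.2 φ hφ hc
    have i1 : Integrable (fun x => φ x * g x) volume := by
      simpa [smul_eq_mul] using hg.2.1.integrable_smul_left_of_hasCompactSupport hφ.continuous hc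
    have i2 : Integrable (fun x => φ x * h x) volume := by
      simpa [smul_eq_mul] using hh.2.1.integrable_smul_left_of_hasCompactSupport hφ.continuous hc
    have e3 : ∫ x, φ x * g x = ∫ x, φ x * h x := by
      have a1 : ∫ x, φ x * g x = ∫ x, g x * φ x := by simp only [mul_comm]
      have a2 : ∫ x, φ x * h x = ∫ x, h x * φ x := by simp only [mul_comm]
      rw [a1, a2]
      linarith
    have e4 : ∫ x, φ x • (g - h) x = ∫ x, (φ x * g x - φ x * h x) := by
      simp only [Pi.sub_apply, smul_eq_mul, mul_sub]
    rw [e4, integral_sub i1 i2, e3, sub_self]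
  filter_upwards [key] with x hx
  exact sub_eq_zero.mp hx

/-- `f` has a weak derivative in `L¹_loc(ℝ)`. -/
def WeaklyDifferentiable (f : ℝ → ℝ) : Prop := ∃ g, HasWeakDeriv f g

open Classical in
/-- The weak derivative of `f` (a representative of it; `0` if there is none). -/
def weakDeriv (f : ℝ → ℝ) : ℝ → ℝ :=
  if h : WeaklyDifferentiable f then h.choose else 0

theorem WeaklyDifferentiable.hasWeakDeriv {f : ℝ → ℝ} (h : WeaklyDifferentiable f) :
    HasWeakDeriv f (weakDeriv f) := by
  unfold weakDeriv
  rw [dif_pos h]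
  exact h.choose_spec

/-- `f ∈ V = {f ∈ C_b(ℝ) | f_ξ ∈ L²(ℝ)}`. -/
def MemV (f : ℝ → ℝ) : Prop :=
  Continuous f ∧ MemLp f ⊤ volume ∧ WeaklyDifferentiable f ∧ MemLp (weakDeriv f) 2 volume

/-- `f` is the continuous representative of an element of `H¹(ℝ)`. -/
def MemH1 (f : ℝ → ℝ) : Prop :=
  Continuous f ∧ MemLp f 2 volume ∧ WeaklyDifferentiable f ∧ MemLp (weakDeriv f) 2 volume

/-- `f ∈ W^{1,∞}(ℝ)`. -/
def MemW1Infty (f : ℝ → ℝ) : Prop :=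
  MemLp f ⊤ volume ∧ WeaklyDifferentiable f ∧ MemLp (weakDeriv f) ⊤ volume

/-- `‖f‖_V = ‖f‖_{L^∞} + ‖f_ξ‖_{L²}`. -/
def normV (f : ℝ → ℝ) : ℝ≥0∞ := eLpNorm f ⊤ volume + eLpNorm (weakDeriv f) 2 volume

/-- `‖f‖_{H¹} = (‖f‖_{L²}² + ‖f_ξ‖_{L²}²)^{1/2}`. -/
def normH1 (f : ℝ → ℝ) : ℝ≥0∞ :=
  (eLpNorm f 2 volume ^ 2 + eLpNorm (weakDeriv f) 2 volume ^ 2) ^ (1 / 2 : ℝ)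

/-- `‖f‖_{W^{1,∞}} = ‖f‖_{L^∞} + ‖f_ξ‖_{L^∞}`. -/
def normW1Infty (f : ℝ → ℝ) : ℝ≥0∞ := eLpNorm f ⊤ volume + eLpNorm (weakDeriv f) ⊤ volume

/-- A triple `(y, U, H)` of functions, in Lagrangian variables. -/
@[ext]
structure Lagrangian where
  y : ℝ → ℝ
  U : ℝ → ℝ
  H : ℝ → ℝ

namespace Lagrangian

/-- `ζ(ξ) = y(ξ) - ξ`. -/
def zeta (X : Lagrangian) : ℝ → ℝ := fun ξ => X.y ξ - ξ

/-- `X ∘ f = (y ∘ f, U ∘ f, H ∘ f)`. -/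
def comp (X : Lagrangian) (f : ℝ → ℝ) : Lagrangian := ⟨X.y ∘ f, X.U ∘ f, X.H ∘ f⟩

/-- `(ζ, U, H) ∈ E = V × H¹ × V`. -/
def MemE (X : Lagrangian) : Prop := MemV X.zeta ∧ MemH1 X.U ∧ MemV X.H

/-- The distance `‖X - Y‖` in the norm
`‖(ζ, U, H)‖ = ‖ζ‖_V + ‖U‖_{H¹} + ‖H‖_V` of `E`. -/
def distE (X Y : Lagrangian) : ℝ≥0∞ :=
  normV (X.zeta - Y.zeta) + normH1 (X.U - Y.U) + normV (X.H - Y.H)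

/-- The set `𝒢` of Lagrangian coordinates. -/
structure MemG (X : Lagrangian) : Prop where
  memE : X.MemE
  zeta_mem : MemW1Infty X.zeta
  U_mem : MemW1Infty X.U
  H_mem : MemW1Infty X.H
  y_deriv_nonneg : ∀ᵐ ξ, 0 ≤ weakDeriv X.y ξ
  H_deriv_nonneg : ∀ᵐ ξ, 0 ≤ weakDeriv X.H ξ
  deriv_pos : ∀ᵐ ξ, 0 < weakDeriv X.y ξ + weakDeriv X.H ξ
  H_atBot : Tendsto X.H atBot (𝓝 0)
  energy : ∀ᵐ ξ, weakDeriv X.y ξ * weakDeriv X.H ξ =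
    weakDeriv X.y ξ ^ 2 * X.U ξ ^ 2 + weakDeriv X.U ξ ^ 2

end Lagrangian

/-- The group `G` of relabeling functions: homeomorphisms `f` of `ℝ` such that `f - id` and
`f⁻¹ - id` belong to `W^{1,∞}` and `f_ξ - 1` belongs to `L²`. -/
def relabelings : Set (ℝ ≃ₜ ℝ) :=
  {f | MemW1Infty (fun ξ => f ξ - ξ) ∧ MemW1Infty (fun ξ => f.symm ξ - ξ) ∧
    MemLp (fun ξ => weakDeriv f ξ - 1) 2 volume}

/-- `G_κ = {f ∈ G | ‖f - id‖_{W^{1,∞}} + ‖f⁻¹ - id‖_{W^{1,∞}} ≤ κ}`. -/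
def relabelingsBounded (κ : ℝ) : Set (ℝ ≃ₜ ℝ) :=
  {f | f ∈ relabelings ∧
    normW1Infty (fun ξ => f ξ - ξ) + normW1Infty (fun ξ => f.symm ξ - ξ) ≤ ENNReal.ofReal κ}

/-- `ℱ_κ = {X ∈ 𝒢 | y + H ∈ G_κ}`. In particular `setF 0` is `ℱ₀`. -/
def setF (κ : ℝ) : Set Lagrangian :=
  {X | X.MemG ∧ ∃ f ∈ relabelingsBounded κ, ∀ ξ, f ξ = X.y ξ + X.H ξ}

/-- `J(X, Y) = inf_{f₁, f₂ ∈ G} (‖X ∘ f₁ - Y‖ + ‖X - Y ∘ f₂‖)`. -/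
def J (X Y : Lagrangian) : ℝ≥0∞ :=
  ⨅ f₁ ∈ relabelings, ⨅ f₂ ∈ relabelings,
    ((X.comp f₁).distE Y + X.distE (Y.comp f₂))

/-- `d(X, Y) = inf ∑_{n=1}^N J(X_{n-1}, X_n)` over all finite sequences `X_0, …, X_N` in `ℱ₀`
with `X_0 = X` and `X_N = Y`. -/
def d (X Y : Lagrangian) : ℝ≥0∞ :=
  ⨅ (N : ℕ) (Z : ℕ → Lagrangian) (_ : ∀ n ≤ N, Z n ∈ setF 0) (_ : Z 0 = X) (_ : Z N = Y),
    ∑ n ∈ Finset.range N, J (Z n) (Z (n + 1))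

/-- The set `𝒟` of Eulerian coordinates: pairs `(u, μ)` where `u ∈ H¹(ℝ)` (given by its continuous
representative) and `μ` is a finite positive Radon measure on `ℝ` whose absolutely continuous
part is `(u² + u_x²) dx`. Finite Borel measures on `ℝ` are automatically Radon. -/
structure Eulerian where
  u : ℝ → ℝ
  μ : Measure ℝ
  u_mem : MemH1 u
  finite : IsFiniteMeasure μ
  ac_part : volume.withDensity (μ.rnDeriv volume) =
    volume.withDensity (fun x => ENNReal.ofReal (u x ^ 2 + weakDeriv u x ^ 2))

namespace Eulerian

/-- `y(ξ) = sup {y | μ((-∞, y)) + y < ξ}`. -/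
def char (p : Eulerian) (ξ : ℝ) : ℝ := sSup {y : ℝ | p.μ.real (Set.Iio y) + y < ξ}

/-- The map `L`, which sends `(u, μ)` to `(y, U, H)` with `y` as in `char`, `U = u ∘ y` and
`H(ξ) = ξ - y(ξ)`. -/
def L (p : Eulerian) : Lagrangian := ⟨p.char, p.u ∘ p.char, fun ξ => ξ - p.char ξ⟩

/-- The metric `d_𝒟((u, μ), (u', μ')) = d(L(u, μ), L(u', μ'))`. -/
def dD (p q : Eulerian) : ℝ≥0∞ := d p.L q.L

end Eulerian

end CamassaHolm

end

namespace CamassaHolm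

/-! The point is that `d` dominates the uniform distances of `y` and `U`, although relabelings enter
`J`. On `ℱ₀` one has `y + H = id`, so if `X ∘ f` is close to `Y`, then `f` is uniformly close to the
identity. Since `y` and `U` are 1-Lipschitz on `ℱ₀`, the relabeling can be removed at the cost of a
factor 2 (`edist_le_distE`), and the triangle inequality along chains passes the bound on to `d`
(`edist_le_d`).

Back in Eulerian variables, each `y_n` is onto and the limit `u` is uniformly continuous, so uniform
convergence of `y_n` and `u_n ∘ y_n` gives that of `u_n` (`tendstoUniformly_u`). Moreover `y` pushes
Lebesgue measure forward to `μ + dx` (`map_char`), so `∫ φ dμ_n = ∫ φ ∘ y_n - ∫ φ` for compactly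
supported `φ`, and dominated convergence applies. Eventually bounded masses extend this to `C₀`. -/

/-! ### Fundamental theorem of calculus for weak derivatives -/

theorem deriv_smoothTransition_eq_zero {x : ℝ} (hx : x ∉ Set.Icc (0 : ℝ) 1) :
    deriv Real.smoothTransition x = 0 := by
  rw [Set.mem_Icc, not_and_or, not_le, not_le] at hx
  rcases hx with hx | hx
  · have : Real.smoothTransition =ᶠ[𝓝 x] fun _ => 0 := by
      filter_upwards [gt_mem_nhds hx] with z hz
      exact Real.smoothTransition.zero_of_nonpos hz.le
    rw [this.deriv_eq, deriv_const]
  · have : Real.smoothTransition =ᶠ[𝓝 x] fun _ => 1 := by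
      filter_upwards [lt_mem_nhds hx] with z hz
      exact Real.smoothTransition.one_of_one_le hz.le
    rw [this.deriv_eq, deriv_const]

theorem contDiff_smoothTransition : ContDiff ℝ (⊤ : ℕ∞) Real.smoothTransition :=
  Real.smoothTransition.contDiff

theorem continuous_deriv_smoothTransition : Continuous (deriv Real.smoothTransition) :=
  contDiff_smoothTransition.continuous_deriv (by simp)

theorem hasCompactSupport_deriv_smoothTransition :
    HasCompactSupport (deriv Real.smoothTransition) :=
  HasCompactSupport.intro isCompact_Icc fun _ hx => deriv_smoothTransition_eq_zero hx

theorem integral_deriv_smoothTransition : ∫ t, deriv Real.smoothTransition t = 1 := by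
  have h := integral_of_hasDerivAt_of_tendsto (f := Real.smoothTransition)
    (f' := deriv Real.smoothTransition) (m := 0) (n := 1)
    (fun x => (contDiff_smoothTransition.differentiable (by simp) x).hasDerivAt)
    (continuous_deriv_smoothTransition.integrable_of_hasCompactSupport
      hasCompactSupport_deriv_smoothTransition)
    (tendsto_const_nhds.congr' (by
      filter_upwards [eventually_le_atBot (0 : ℝ)] with x hx
      exact (Real.smoothTransition.zero_of_nonpos hx).symm))
    (tendsto_const_nhds.congr' (by
      filter_upwards [eventually_ge_atTop (1 : ℝ)] with x hx
      exact (Real.smoothTransition.one_of_one_le hx).symm))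
  simpa using h

/-- The kernels `N T'(N (x - c))`, with `T` the smooth transition, concentrate at `c`. -/
theorem tendsto_integral_mul_deriv_smoothTransition {f : ℝ → ℝ} (hf : Continuous f) (c : ℝ) :
    Tendsto (fun n : ℕ => ∫ x, f x * ((n + 1 : ℝ) *
      deriv Real.smoothTransition ((n + 1 : ℝ) * (x - c)))) atTop (𝓝 (f c)) := by
  -- Substituting `t = (n + 1)(x - c)` fixes the kernel and moves the dependence on `n` into the
  -- argument of `f`.
  have hsub : ∀ n : ℕ, ∫ x, f x * ((n + 1 : ℝ) *
      deriv Real.smoothTransition ((n + 1 : ℝ) * (x - c))) =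
      ∫ t, f (c + t / (n + 1 : ℝ)) * deriv Real.smoothTransition t := by
    intro n
    have hn : (0 : ℝ) < n + 1 := by positivity
    have e1 := Measure.integral_comp_mul_left
      (fun t => f (c + t / (n + 1 : ℝ)) * ((n + 1 : ℝ) * deriv Real.smoothTransition t)) (n + 1 : ℝ)
    have e2 := integral_sub_right_eq_self (μ := volume)
      (fun x => f (c + (n + 1 : ℝ) * x / (n + 1 : ℝ)) *
      ((n + 1 : ℝ) * deriv Real.smoothTransition ((n + 1 : ℝ) * x))) c
    have e3 : ∀ x : ℝ, c + (n + 1 : ℝ) * (x - c) / (n + 1 : ℝ) = x := by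
      intro x; field_simp; ring
    simp only [e3] at e2
    rw [e2, e1, abs_of_pos (inv_pos.2 hn), smul_eq_mul, ← integral_const_mul]
    congr 1
    ext t
    field_simp
  simp only [hsub]
  obtain ⟨M, hM⟩ := (isCompact_Icc (a := c) (b := c + 1)).exists_bound_of_continuousOn
    hf.continuousOn
  have hint : Integrable (deriv Real.smoothTransition) volume :=
    continuous_deriv_smoothTransition.integrable_of_hasCompactSupport
      hasCompactSupport_deriv_smoothTransition
  have key := tendsto_integral_of_dominated_convergence (μ := volume)
    (F := fun (n : ℕ) t => f (c + t / (n + 1 : ℝ)) * deriv Real.smoothTransition t)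
    (f := fun t => f c * deriv Real.smoothTransition t)
    (fun t => M * ‖deriv Real.smoothTransition t‖) ?_ (hint.norm.const_mul M) ?_ ?_
  · rwa [integral_const_mul, integral_deriv_smoothTransition, mul_one] at key
  · intro n
    have := continuous_deriv_smoothTransition
    exact Continuous.aestronglyMeasurable (by fun_prop)
  · intro n
    refine Eventually.of_forall fun t => ?_
    by_cases ht : t ∈ Set.Icc (0 : ℝ) 1
    · rw [norm_mul]
      refine mul_le_mul_of_nonneg_right (hM _ ⟨?_, ?_⟩) (norm_nonneg _)
      · have : 0 ≤ t / (n + 1 : ℝ) := div_nonneg ht.1 (by positivity)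
        linarith
      · have : t / (n + 1 : ℝ) ≤ 1 := by
          rw [div_le_one (by positivity)]
          have : (0 : ℝ) ≤ n := Nat.cast_nonneg n
          linarith [ht.2]
        linarith
    · simp [deriv_smoothTransition_eq_zero ht]
  · refine Eventually.of_forall fun t => ?_
    refine Tendsto.mul_const _ ?_
    have h0 : Tendsto (fun n : ℕ => c + t / (n + 1 : ℝ)) atTop (𝓝 (c + 0)) := by
      refine tendsto_const_nhds.add ?_
      have := (tendsto_one_div_add_atTop_nhds_zero_nat (𝕜 := ℝ)).const_mul t
      simpa [div_eq_mul_inv] using this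
    rw [add_zero] at h0
    exact (hf.tendsto c).comp h0

/-- The fundamental theorem of calculus for weak derivatives of continuous functions. -/
theorem HasWeakDeriv.setIntegral_Ioc {f g : ℝ → ℝ} (h : HasWeakDeriv f g) (hf : Continuous f)
    {a b : ℝ} (hab : a ≤ b) : ∫ x in Set.Ioc a b, g x = f b - f a := by
  set T := Real.smoothTransition with hT
  -- Smooth plateaus tending to the indicator of `(a, b]`; their derivatives are differences of
  -- kernels concentrating at `a` and `b`. The ramps have width at most 1, hence the common support
  -- bound `[a, b + 1]`.
  set φ : ℕ → ℝ → ℝ := fun n x => T ((n + 1 : ℝ) * (x - a)) - T ((n + 1 : ℝ) * (x - b)) with hφ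
  have hTd : ContDiff ℝ (⊤ : ℕ∞) T := contDiff_smoothTransition
  have hsm : ∀ n, ContDiff ℝ (⊤ : ℕ∞) (φ n) := fun n => by
    have h1 : ∀ c : ℝ, ContDiff ℝ (⊤ : ℕ∞) (fun x : ℝ => T ((n + 1 : ℝ) * (x - c))) := fun c =>
      hTd.comp (contDiff_const.mul (contDiff_id.sub contDiff_const))
    exact (h1 a).sub (h1 b)
  have hzero : ∀ n, ∀ x ∉ Set.Icc a (b + 1), φ n x = 0 := by
    intro n x hx
    have hn : (0 : ℝ) ≤ n := Nat.cast_nonneg n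
    rw [Set.mem_Icc, not_and_or, not_le, not_le] at hx
    rcases hx with hx | hx
    · simp only [hφ, hT]
      rw [Real.smoothTransition.zero_of_nonpos, Real.smoothTransition.zero_of_nonpos, sub_zero]
      · nlinarith
      · nlinarith
    · simp only [hφ, hT]
      rw [Real.smoothTransition.one_of_one_le, Real.smoothTransition.one_of_one_le, sub_self]
      · nlinarith
      · nlinarith
  have hcs : ∀ n, HasCompactSupport (φ n) := fun n => HasCompactSupport.intro isCompact_Icc (hzero n)
  have hder : ∀ n x, deriv (φ n) x = (n + 1 : ℝ) * deriv T ((n + 1 : ℝ) * (x - a)) -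
      (n + 1 : ℝ) * deriv T ((n + 1 : ℝ) * (x - b)) := by
    intro n x
    have h1 : ∀ c : ℝ, HasDerivAt (fun x : ℝ => T ((n + 1 : ℝ) * (x - c)))
        (deriv T ((n + 1 : ℝ) * (x - c)) * ((n + 1 : ℝ) * 1)) x := fun c =>
      HasDerivAt.comp x (hTd.differentiable (by simp) _).hasDerivAt
        (((hasDerivAt_id x).sub_const c).const_mul _)
    refine ((h1 a).sub (h1 b)).deriv.trans ?_
    ring
  have hLHS : Tendsto (fun n => ∫ x, f x * deriv (φ n) x) atTop (𝓝 (f a - f b)) := by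
    refine ((tendsto_integral_mul_deriv_smoothTransition hf a).sub
      (tendsto_integral_mul_deriv_smoothTransition hf b)).congr fun n => ?_
    have hi : ∀ c : ℝ, Integrable (fun x => f x * ((n + 1 : ℝ) *
        deriv T ((n + 1 : ℝ) * (x - c)))) volume := by
      intro c
      have := continuous_deriv_smoothTransition
      refine Continuous.integrable_of_hasCompactSupport (by fun_prop) ?_
      refine HasCompactSupport.intro (isCompact_Icc (a := c) (b := c + 1)) fun x hx => ?_
      rw [deriv_smoothTransition_eq_zero, mul_zero, mul_zero]
      rw [Set.mem_Icc, not_and_or, not_le, not_le] at hx ⊢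
      have hn : (0 : ℝ) ≤ n := Nat.cast_nonneg n
      rcases hx with hx | hx
      · left; nlinarith
      · right; nlinarith
    rw [← integral_sub (hi a) (hi b)]
    simp only [hder, mul_sub]
  -- At `x = c` the limit is 0 because `T 0 = 0`; this is why the limiting interval is open at `a`
  -- and closed at `b`.
  have hlim : ∀ x c : ℝ, Tendsto (fun n : ℕ => T ((n + 1 : ℝ) * (x - c))) atTop
      (𝓝 (if c < x then 1 else 0)) := by
    intro x c
    split_ifs with hc
    · refine tendsto_const_nhds.congr' ?_
      obtain ⟨N, hN⟩ := exists_nat_ge (1 / (x - c))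
      filter_upwards [eventually_ge_atTop N] with n hn
      rw [hT, Real.smoothTransition.one_of_one_le]
      have : (N : ℝ) ≤ n := by exact_mod_cast hn
      rw [div_le_iff₀ (by linarith)] at hN
      nlinarith
    · refine tendsto_const_nhds.congr fun n => ?_
      rw [hT, Real.smoothTransition.zero_of_nonpos]
      have hn : (0 : ℝ) ≤ n := Nat.cast_nonneg n
      nlinarith
  have hRHS : Tendsto (fun n => ∫ x, g x * φ n x) atTop (𝓝 (∫ x in Set.Ioc a b, g x)) := by
    rw [← integral_indicator measurableSet_Ioc]
    refine tendsto_integral_of_dominated_convergence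
      ((Set.Icc a (b + 1)).indicator fun x => ‖g x‖) ?_ ?_ ?_ ?_
    · intro n
      exact h.2.1.aestronglyMeasurable.mul (hsm n).continuous.aestronglyMeasurable
    · exact (integrable_indicator_iff measurableSet_Icc).2
        (h.2.1.integrableOn_isCompact isCompact_Icc).norm
    · intro n
      refine Eventually.of_forall fun x => ?_
      by_cases hx : x ∈ Set.Icc a (b + 1)
      · rw [Set.indicator_of_mem hx, norm_mul]
        refine mul_le_of_le_one_right (norm_nonneg _) ?_
        rw [Real.norm_eq_abs, abs_le]
        have h0 := Real.smoothTransition.nonneg ((n + 1 : ℝ) * (x - a))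
        have h1 := Real.smoothTransition.le_one ((n + 1 : ℝ) * (x - a))
        have h2 := Real.smoothTransition.nonneg ((n + 1 : ℝ) * (x - b))
        have h3 := Real.smoothTransition.le_one ((n + 1 : ℝ) * (x - b))
        simp only [hφ, hT]
        constructor <;> linarith
      · rw [hzero n x hx, mul_zero, norm_zero]
        exact Set.indicator_nonneg (fun _ _ => norm_nonneg _) _
    · refine Eventually.of_forall fun x => ?_
      have := ((hlim x a).sub (hlim x b)).const_mul (g x)
      convert this using 2
      simp only [Set.indicator, Set.mem_Ioc]
      grind
  have hEq : ∀ n, ∫ x, f x * deriv (φ n) x = -∫ x, g x * φ n x := fun n =>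
    h.2.2 _ (hsm n) (hcs n)
  have := tendsto_nhds_unique (hLHS.congr hEq) hRHS.neg
  linarith

/-! ### Sums and Lipschitz functions -/

theorem HasWeakDeriv.integrable_mul {f g φ : ℝ → ℝ} (h : HasWeakDeriv f g)
    (hφ : ContDiff ℝ (⊤ : ℕ∞) φ) (hc : HasCompactSupport φ) :
    Integrable (fun x => f x * deriv φ x) volume ∧ Integrable (fun x => g x * φ x) volume := by
  constructor
  · have := h.1.integrable_smul_left_of_hasCompactSupport
      (hφ.continuous_deriv (by simp)) hc.deriv
    simpa [smul_eq_mul, mul_comm] using this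
  · have := h.2.1.integrable_smul_left_of_hasCompactSupport hφ.continuous hc
    simpa [smul_eq_mul, mul_comm] using this

theorem HasWeakDeriv.add {f g f' g' : ℝ → ℝ} (h : HasWeakDeriv f f') (k : HasWeakDeriv g g') :
    HasWeakDeriv (f + g) (f' + g') := by
  refine ⟨h.1.add k.1, h.2.1.add k.2.1, fun φ hφ hc => ?_⟩
  simp only [Pi.add_apply, add_mul]
  rw [integral_add (h.integrable_mul hφ hc).1 (k.integrable_mul hφ hc).1,
    integral_add (h.integrable_mul hφ hc).2 (k.integrable_mul hφ hc).2, h.2.2 φ hφ hc,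
    k.2.2 φ hφ hc]
  ring

/-- Integration by parts for the line derivative in direction 1. It is needed for relabeled
functions: `weakDeriv` defaults to 0, so `normH1` controls oscillation only once weak
differentiability is known. -/
theorem LipschitzWith.hasWeakDeriv {C : NNReal} {f : ℝ → ℝ} (hf : LipschitzWith C f) :
    HasWeakDeriv f (fun x => lineDeriv ℝ f x 1) := by
  refine ⟨hf.continuous.locallyIntegrable, hf.locallyIntegrable_lineDeriv 1, fun φ hφ hc => ?_⟩
  obtain ⟨D, hD⟩ := ContDiff.lipschitzWith_of_hasCompactSupport hc hφ (by simp)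
  have h := hf.integral_lineDeriv_mul_eq (μ := volume) hD hc 1
  rw [h, ← integral_neg]
  congr 1
  ext x
  rw [(hφ.differentiable (by simp) x).lineDeriv_eq_fderiv, map_neg, fderiv_apply_one_eq_deriv]
  ring

theorem LipschitzWith.weaklyDifferentiable {C : NNReal} {f : ℝ → ℝ} (hf : LipschitzWith C f) :
    WeaklyDifferentiable f := ⟨_, LipschitzWith.hasWeakDeriv hf⟩

theorem WeaklyDifferentiable.add {f g : ℝ → ℝ} (hf : WeaklyDifferentiable f)
    (hg : WeaklyDifferentiable g) : WeaklyDifferentiable (f + g) :=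
  ⟨_, hf.hasWeakDeriv.add hg.hasWeakDeriv⟩

/-! ### Pointwise bounds from norms -/

/-- The bound holds on a closed set of full measure, and such a set is dense, hence everything. -/
theorem enorm_le_eLpNorm_top {f : ℝ → ℝ} (hf : Continuous f) (x : ℝ) :
    ‖f x‖ₑ ≤ eLpNorm f ⊤ volume := by
  have h : ∀ᵐ x, ‖f x‖ₑ ≤ eLpNorm f ⊤ volume := by
    rw [eLpNorm_exponent_top]
    exact ae_le_eLpNormEssSup
  have hd := Measure.dense_of_ae h
  have hcl : IsClosed {x | ‖f x‖ₑ ≤ eLpNorm f ⊤ volume} :=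
    isClosed_le hf.enorm continuous_const
  have := hcl.closure_eq ▸ hd x
  exact this

/-- Hölder continuity of functions with a weak derivative in `L²`. -/
theorem HasWeakDeriv.enorm_sub_le {f g : ℝ → ℝ} (h : HasWeakDeriv f g) (hf : Continuous f)
    (a b : ℝ) :
    ‖f b - f a‖ₑ ≤ eLpNorm g 2 volume * ENNReal.ofReal |b - a| ^ (1 / 2 : ℝ) := by
  wlog hab : a ≤ b generalizing a b
  · have := this b a (le_of_not_ge hab)
    rwa [abs_sub_comm, ← neg_sub, enorm_neg] at this
  rw [← h.setIntegral_Ioc hf hab]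
  refine (enorm_integral_le_lintegral_enorm _).trans ?_
  rw [← eLpNorm_one_eq_lintegral_enorm]
  have h1 := eLpNorm_le_eLpNorm_mul_rpow_measure_univ (p := 1) (q := 2)
    (μ := volume.restrict (Set.Ioc a b)) (f := g) (by norm_num)
    h.2.1.aestronglyMeasurable.restrict
  refine h1.trans ?_
  have e : (1 / (1 : ℝ≥0∞).toReal - 1 / (2 : ℝ≥0∞).toReal) = (1 / 2 : ℝ) := by norm_num
  rw [e, Measure.restrict_apply_univ, Real.volume_Ioc, abs_of_nonneg (sub_nonneg.2 hab)]
  gcongr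
  exact Measure.restrict_le_self

theorem eLpNorm_two_le_normH1 (f : ℝ → ℝ) :
    eLpNorm f 2 volume ≤ normH1 f ∧ eLpNorm (weakDeriv f) 2 volume ≤ normH1 f := by
  have hsq : ∀ a : ℝ≥0∞, a = (a ^ 2) ^ (1 / 2 : ℝ) := fun a => by
    rw [← ENNReal.rpow_natCast, ← ENNReal.rpow_mul]; simp
  constructor
  · conv_lhs => rw [hsq (eLpNorm f 2 volume)]
    exact ENNReal.rpow_le_rpow le_self_add (by norm_num)
  · conv_lhs => rw [hsq (eLpNorm (weakDeriv f) 2 volume)]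
    exact ENNReal.rpow_le_rpow le_add_self (by norm_num)

/-- The Sobolev embedding `H¹(ℝ) ⊆ L^∞(ℝ)`. -/
theorem enorm_le_two_mul_normH1 {f : ℝ → ℝ} (hf : Continuous f) (hw : WeaklyDifferentiable f)
    (x : ℝ) : ‖f x‖ₑ ≤ 2 * normH1 f := by
  obtain ⟨h0, h1⟩ := eLpNorm_two_le_normH1 f
  -- Averaging this over a unit interval gives the factor 2: one `normH1` from the mean of `|f|` by
  -- Hölder, one from the oscillation.
  have hpt : ∀ z ∈ Set.Ioc x (x + 1), ‖f x‖ₑ ≤ ‖f z‖ₑ + normH1 f := by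
    intro z hz
    have e := hw.hasWeakDeriv.enorm_sub_le hf z x
    have e1 : f x = f z + (f x - f z) := by ring
    rw [e1]
    refine (enorm_add_le _ _).trans ?_
    gcongr
    refine e.trans ((mul_le_of_le_one_right' ?_).trans h1)
    refine ENNReal.rpow_le_one ?_ (by norm_num)
    rw [ENNReal.ofReal_le_one, abs_le]
    constructor <;> linarith [hz.1, hz.2]
  have hvol : volume (Set.Ioc x (x + 1)) = 1 := by simp
  have hint : ‖f x‖ₑ ≤ ∫⁻ z in Set.Ioc x (x + 1), (‖f z‖ₑ + normH1 f) := by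
    have := setLIntegral_mono' (μ := volume) (measurableSet_Ioc (a := x) (b := x + 1)) hpt
    rwa [setLIntegral_const, hvol, mul_one] at this
  refine hint.trans ?_
  rw [lintegral_add_right _ measurable_const, setLIntegral_const, hvol, mul_one, two_mul]
  gcongr
  rw [← eLpNorm_one_eq_lintegral_enorm]
  have h2 := eLpNorm_le_eLpNorm_mul_rpow_measure_univ (p := 1) (q := 2)
    (μ := volume.restrict (Set.Ioc x (x + 1))) (f := f) (by norm_num)
    hf.aestronglyMeasurable
  rw [Measure.restrict_apply_univ, hvol, ENNReal.one_rpow, mul_one] at h2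
  exact h2.trans ((eLpNorm_mono_measure _ Measure.restrict_le_self).trans h0)

/-- A continuous function whose weak derivative is bounded by `C` is `C`-Lipschitz. -/
theorem HasWeakDeriv.abs_sub_le {f g : ℝ → ℝ} (h : HasWeakDeriv f g) (hf : Continuous f) {C : ℝ}
    (hC : ∀ᵐ x, |g x| ≤ C) (a b : ℝ) : |f b - f a| ≤ C * |b - a| := by
  wlog hab : a ≤ b generalizing a b
  · rw [abs_sub_comm, abs_sub_comm b]
    exact this b a (le_of_not_ge hab)
  rw [← h.setIntegral_Ioc hf hab, ← Real.norm_eq_abs]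
  refine (norm_setIntegral_le_of_norm_le_const_ae (by simp) (ae_restrict_of_ae hC)).trans ?_
  rw [measureReal_def, Real.volume_Ioc, ENNReal.toReal_ofReal (sub_nonneg.2 hab),
    abs_of_nonneg (sub_nonneg.2 hab)]

theorem MemW1Infty.exists_lipschitzWith {f : ℝ → ℝ} (h : MemW1Infty f) (hf : Continuous f) :
    ∃ C : NNReal, LipschitzWith C f := by
  refine ⟨(eLpNorm (weakDeriv f) ⊤ volume).toNNReal, LipschitzWith.of_dist_le_mul fun a b => ?_⟩
  rw [dist_comm, Real.dist_eq, dist_comm, Real.dist_eq]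
  refine h.2.1.hasWeakDeriv.abs_sub_le hf ?_ a b
  have hfin := h.2.2.eLpNorm_lt_top.ne
  rw [eLpNorm_exponent_top] at hfin ⊢
  filter_upwards [ae_le_eLpNormEssSup (f := weakDeriv f) (μ := volume)] with x hx
  have := ENNReal.toReal_mono hfin hx
  rwa [toReal_enorm, Real.norm_eq_abs] at this

theorem hasWeakDeriv_id : HasWeakDeriv (fun x => x) (fun _ => 1) := by
  have h := LipschitzWith.hasWeakDeriv (f := fun x : ℝ => x) LipschitzWith.id
  convert h using 2 with x
  rw [differentiableAt_fun_id.lineDeriv_eq_fderiv, fderiv_apply_one_eq_deriv, deriv_id'']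

theorem HasWeakDeriv.monotone {f g : ℝ → ℝ} (h : HasWeakDeriv f g) (hf : Continuous f)
    (hg : ∀ᵐ x, 0 ≤ g x) : Monotone f := by
  intro a b hab
  rw [← sub_nonneg, ← h.setIntegral_Ioc hf hab]
  exact integral_nonneg_of_ae (ae_restrict_of_ae hg)

theorem relabelings.lipschitz {f : ℝ ≃ₜ ℝ} (hf : f ∈ relabelings) :
    ∃ C : NNReal, LipschitzWith C f := by
  obtain ⟨C, hC⟩ := MemW1Infty.exists_lipschitzWith hf.1 (f.continuous.sub continuous_id)
  refine ⟨C + 1, ?_⟩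
  have := hC.add LipschitzWith.id
  simpa using this

/-! ### Rigidity of `ℱ₀` and comparison of `d` with the uniform distance -/

namespace Lagrangian

theorem MemG.continuous_y {X : Lagrangian} (hX : X.MemG) : Continuous X.y := by
  have := hX.memE.1.1.add continuous_id
  convert this using 1
  ext ξ
  simp [zeta]

theorem MemG.continuous_H {X : Lagrangian} (hX : X.MemG) : Continuous X.H := hX.memE.2.2.1

theorem MemG.continuous_U {X : Lagrangian} (hX : X.MemG) : Continuous X.U := hX.memE.2.1.1

theorem MemG.weaklyDifferentiable_y {X : Lagrangian} (hX : X.MemG) :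
    WeaklyDifferentiable X.y := by
  have h := hX.memE.1.2.2.1.add ⟨_, hasWeakDeriv_id⟩
  convert h using 1
  ext ξ
  simp [zeta]

theorem MemG.monotone_y {X : Lagrangian} (hX : X.MemG) : Monotone X.y :=
  hX.weaklyDifferentiable_y.hasWeakDeriv.monotone hX.continuous_y hX.y_deriv_nonneg

theorem MemG.monotone_H {X : Lagrangian} (hX : X.MemG) : Monotone X.H :=
  hX.memE.2.2.2.2.1.hasWeakDeriv.monotone hX.continuous_H hX.H_deriv_nonneg

theorem y_add_H {X : Lagrangian} (hX : X ∈ setF 0) (ξ : ℝ) : X.y ξ + X.H ξ = ξ := by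
  obtain ⟨-, f, ⟨-, hf⟩, hfX⟩ := hX
  rw [ENNReal.ofReal_zero, nonpos_iff_eq_zero, add_eq_zero] at hf
  have h0 := enorm_le_eLpNorm_top (f.continuous.sub continuous_id) ξ
  have h1 : eLpNorm (fun ξ => f ξ - ξ) ⊤ volume = 0 := (add_eq_zero.1 hf.1).1
  have h2 : ‖f ξ - ξ‖ₑ = 0 := le_antisymm (h0.trans h1.le) bot_le
  rw [enorm_eq_zero] at h2
  rw [← hfX]
  linarith

theorem abs_y_sub_le {X : Lagrangian} (hX : X ∈ setF 0) (a b : ℝ) :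
    |X.y b - X.y a| ≤ |b - a| := by
  wlog hab : a ≤ b generalizing a b
  · rw [abs_sub_comm, abs_sub_comm b]
    exact this b a (le_of_not_ge hab)
  have h1 := hX.1.monotone_y hab
  have h2 := hX.1.monotone_H hab
  have h3 := y_add_H hX a
  have h4 := y_add_H hX b
  rw [abs_of_nonneg (by linarith), abs_of_nonneg (by linarith)]
  linarith

/-- The energy identity gives `U_ξ² ≤ y_ξ H_ξ`, and `y_ξ`, `H_ξ` are nonnegative with sum 1. -/
theorem abs_U_sub_le {X : Lagrangian} (hX : X ∈ setF 0) (a b : ℝ) :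
    |X.U b - X.U a| ≤ |b - a| := by
  have hsum : HasWeakDeriv (fun x => x) (weakDeriv X.y + weakDeriv X.H) := by
    have h := hX.1.weaklyDifferentiable_y.hasWeakDeriv.add hX.1.memE.2.2.2.2.1.hasWeakDeriv
    convert h using 1
    ext ξ
    exact (y_add_H hX ξ).symm
  have h := hX.1.memE.2.1.2.2.1.hasWeakDeriv.abs_sub_le hX.1.continuous_U (C := 1) ?_ a b
  · rwa [one_mul] at h
  filter_upwards [hX.1.y_deriv_nonneg, hX.1.H_deriv_nonneg, hX.1.energy,
    hsum.ae_eq hasWeakDeriv_id] with ξ h1 h2 h3 h4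
  rw [Pi.add_apply] at h4
  refine abs_le_one_iff_mul_self_le_one.2 ?_
  nlinarith [sq_nonneg (weakDeriv X.y ξ * X.U ξ)]

theorem lipschitzWith_U {X : Lagrangian} (hX : X ∈ setF 0) : LipschitzWith 1 X.U :=
  LipschitzWith.of_dist_le_mul fun a b => by
    simpa [Real.dist_eq] using abs_U_sub_le hX b a

theorem enorm_le_enorm_of_abs_le {a b : ℝ} (h : |a| ≤ |b|) : ‖a‖ₑ ≤ ‖b‖ₑ :=
  enorm_le_iff_norm_le.2 h

/-- On `ℱ₀` the uniform distance is controlled by the distance after relabeling. -/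
theorem edist_le_distE {X Y : Lagrangian} (hX : X ∈ setF 0) (hY : Y ∈ setF 0) {f : ℝ ≃ₜ ℝ}
    (hf : f ∈ relabelings) (ξ : ℝ) :
    edist (X.y ξ) (Y.y ξ) ≤ 2 * (X.comp f).distE Y ∧
      edist (X.U ξ) (Y.U ξ) ≤ 2 * (X.comp f).distE Y := by
  have hy : ‖X.y (f ξ) - Y.y ξ‖ₑ ≤ normV ((X.comp f).zeta - Y.zeta) := by
    have hc : Continuous ((X.comp f).zeta - Y.zeta) :=
      ((hX.1.continuous_y.comp f.continuous).sub continuous_id).sub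
        (hY.1.continuous_y.sub continuous_id)
    refine le_trans (le_of_eq ?_) ((enorm_le_eLpNorm_top hc ξ).trans le_self_add)
    congr 1
    simp [zeta, comp]
  have hH : ‖X.H (f ξ) - Y.H ξ‖ₑ ≤ normV ((X.comp f).H - Y.H) := by
    have hc : Continuous ((X.comp f).H - Y.H) :=
      (hX.1.continuous_H.comp f.continuous).sub hY.1.continuous_H
    exact (enorm_le_eLpNorm_top hc ξ).trans le_self_add
  have hU : ‖X.U (f ξ) - Y.U ξ‖ₑ ≤ 2 * normH1 ((X.comp f).U - Y.U) := by
    obtain ⟨C, hC⟩ := relabelings.lipschitz hf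
    have hL := ((lipschitzWith_U hX).comp hC).sub (lipschitzWith_U hY)
    exact enorm_le_two_mul_normH1 (f := (X.comp f).U - Y.U) hL.continuous
      (LipschitzWith.weaklyDifferentiable hL) ξ
  -- The relabeling is recovered from the triples themselves: `y + H = id` for `X` at `f ξ` and for
  -- `Y` at `ξ`.
  have hfξ : ‖ξ - f ξ‖ₑ ≤ normV ((X.comp f).zeta - Y.zeta) + normV ((X.comp f).H - Y.H) := by
    have e : ξ - f ξ = -((X.y (f ξ) - Y.y ξ) + (X.H (f ξ) - Y.H ξ)) := by
      linarith [y_add_H hX (f ξ), y_add_H hY ξ]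
    rw [e, enorm_neg]
    exact (enorm_add_le _ _).trans (add_le_add hy hH)
  unfold distE
  set A := normV ((X.comp f).zeta - Y.zeta)
  set B := normH1 ((X.comp f).U - Y.U)
  set C := normV ((X.comp f).H - Y.H)
  constructor
  · refine (edist_triangle _ (X.y (f ξ)) _).trans ?_
    rw [edist_eq_enorm_sub, edist_eq_enorm_sub]
    refine (add_le_add ((enorm_le_enorm_of_abs_le (abs_y_sub_le hX _ _)).trans hfξ) hy).trans ?_
    calc A + C + A ≤ A + C + A + (2 * B + C) := le_self_add
      _ = 2 * (A + B + C) := by ring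
  · refine (edist_triangle _ (X.U (f ξ)) _).trans ?_
    rw [edist_eq_enorm_sub, edist_eq_enorm_sub]
    refine (add_le_add ((enorm_le_enorm_of_abs_le (abs_U_sub_le hX _ _)).trans hfξ) hU).trans ?_
    calc A + C + 2 * B ≤ A + C + 2 * B + (A + C) := le_self_add
      _ = 2 * (A + B + C) := by ring

theorem edist_le_J {X Y : Lagrangian} (hX : X ∈ setF 0) (hY : Y ∈ setF 0) (ξ : ℝ) :
    edist (X.y ξ) (Y.y ξ) ≤ 2 * J X Y ∧ edist (X.U ξ) (Y.U ξ) ≤ 2 * J X Y := by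
  have hJ : ∀ a : ℝ≥0∞, (∀ f ∈ relabelings, a ≤ 2 * (X.comp f).distE Y) → a ≤ 2 * J X Y := by
    intro a ha
    unfold J
    rw [← ENNReal.div_le_iff' (by simp) (by simp)]
    -- The first summand of `J` alone suffices.
    refine le_iInf₂ fun f hf => le_iInf₂ fun _ _ => le_add_right ?_
    rw [ENNReal.div_le_iff' (by simp) (by simp)]
    exact ha f hf
  exact ⟨hJ _ fun f hf => (edist_le_distE hX hY hf ξ).1,
    hJ _ fun f hf => (edist_le_distE hX hY hf ξ).2⟩

/-- The metric `d` dominates the uniform distance. -/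
theorem edist_le_d (X Y : Lagrangian) (ξ : ℝ) :
    edist (X.y ξ) (Y.y ξ) ≤ 2 * d X Y ∧ edist (X.U ξ) (Y.U ξ) ≤ 2 * d X Y := by
  have hd : ∀ F : Lagrangian → ℝ, (∀ X ∈ setF 0, ∀ Y ∈ setF 0, edist (F X) (F Y) ≤ 2 * J X Y) →
      edist (F X) (F Y) ≤ 2 * d X Y := by
    intro F hF
    unfold d
    rw [← ENNReal.div_le_iff' (by simp) (by simp)]
    -- Chains lie in `ℱ₀`, so membership of the endpoints need not be known beforehand; without any
    -- chain the infimum is `⊤`.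
    refine le_iInf fun N => le_iInf fun Z => le_iInf fun hZ => le_iInf fun h0 => le_iInf fun hN => ?_
    rw [ENNReal.div_le_iff' (by simp) (by simp), Finset.mul_sum, ← h0, ← hN]
    refine (edist_le_range_sum_edist (fun n => F (Z n)) N).trans (Finset.sum_le_sum fun n hn => ?_)
    have hn := Finset.mem_range.1 hn
    exact hF _ (hZ n hn.le) _ (hZ (n + 1) hn)
  exact ⟨hd (fun X => X.y ξ) fun X hX Y hY => (edist_le_J hX hY ξ).1,
    hd (fun X => X.U ξ) fun X hX Y hY => (edist_le_J hX hY ξ).2⟩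

end Lagrangian

/-! ### The characteristic as a generalized inverse -/

namespace Eulerian

/-- The increasing function `x ↦ μ((-∞, x)) + x`, of which `char` is the generalized inverse. -/
def dist (p : Eulerian) (x : ℝ) : ℝ := p.μ.real (Set.Iio x) + x

theorem le_dist (p : Eulerian) (x : ℝ) : x ≤ p.dist x :=
  le_add_of_nonneg_left measureReal_nonneg

theorem dist_le (p : Eulerian) (x : ℝ) : p.dist x ≤ p.μ.real Set.univ + x := by
  have := p.finite
  exact add_le_add_left (measureReal_mono (Set.subset_univ _)) x

theorem dist_strictMono (p : Eulerian) : StrictMono p.dist := by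
  intro a b hab
  have := p.finite
  exact add_lt_add_of_le_of_lt (measureReal_mono (Set.Iio_subset_Iio hab.le)) hab

/-- Left continuity of `dist`, from continuity of `μ` from below along open half-lines. -/
theorem exists_lt_dist (p : Eulerian) {ξ b : ℝ} (h : ξ < p.dist b) :
    ∃ z < b, ξ < p.dist z := by
  have := p.finite
  obtain ⟨s, hs, hsb, hlim⟩ := exists_seq_strictMono_tendsto b
  have hU : ⋃ n, Set.Iio (s n) = Set.Iio b := by
    ext x
    simp only [Set.mem_iUnion, Set.mem_Iio]
    exact ⟨fun ⟨n, hn⟩ => hn.trans (hsb n),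
      fun hx => ((tendsto_order.1 hlim).1 x hx).exists⟩
  have h1 : Tendsto (fun n => p.μ.real (Set.Iio (s n))) atTop (𝓝 (p.μ.real (Set.Iio b))) := by
    have := tendsto_measure_iUnion_atTop (μ := p.μ) (s := fun n => Set.Iio (s n))
      (fun m n hmn => Set.Iio_subset_Iio (hs.monotone hmn))
    rw [hU] at this
    exact (ENNReal.tendsto_toReal (measure_ne_top _ _)).comp this
  obtain ⟨n, hn⟩ := ((tendsto_order.1 (h1.add hlim)).1 ξ h).exists
  exact ⟨s n, hsb n, hn⟩

theorem bddAbove_char (p : Eulerian) (ξ : ℝ) : BddAbove {y : ℝ | p.dist y < ξ} :=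
  ⟨ξ, fun y hy => (p.le_dist y).trans (le_of_lt hy)⟩

theorem nonempty_char (p : Eulerian) (ξ : ℝ) : {y : ℝ | p.dist y < ξ}.Nonempty :=
  ⟨ξ - p.μ.real Set.univ - 1, by
    have := p.dist_le (ξ - p.μ.real Set.univ - 1)
    exact lt_of_le_of_lt this (by linarith)⟩

/-- The Galois connection from which the other properties of `char` follow. Left continuity of
`dist` is what makes the forward direction hold with a non-strict inequality. -/
theorem le_char_iff (p : Eulerian) {b ξ : ℝ} : b ≤ p.char ξ ↔ p.dist b ≤ ξ := by
  constructor
  · intro h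
    by_contra! hlt
    obtain ⟨z, hz, hz'⟩ := p.exists_lt_dist hlt
    obtain ⟨w, hw, hzw⟩ := exists_lt_of_lt_csSup (p.nonempty_char ξ) (hz.trans_le h)
    exact absurd (p.dist_strictMono hzw) (not_lt.2 ((le_of_lt hw).trans hz'.le))
  · intro h
    refine le_of_forall_lt fun z hz => ?_
    obtain ⟨w, hzw, hwb⟩ := exists_between hz
    exact hzw.trans_le (le_csSup (p.bddAbove_char ξ) ((p.dist_strictMono hwb).trans_le h))

theorem char_lt_iff (p : Eulerian) {b ξ : ℝ} : p.char ξ < b ↔ ξ < p.dist b := by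
  rw [← not_le, le_char_iff, not_le]

theorem char_dist (p : Eulerian) (b : ℝ) : p.char (p.dist b) = b :=
  le_antisymm (le_of_forall_gt fun _ hc => p.char_lt_iff.2 (p.dist_strictMono hc))
    (p.le_char_iff.2 le_rfl)

theorem char_surjective (p : Eulerian) : Function.Surjective p.char :=
  fun b => ⟨_, p.char_dist b⟩

theorem char_le (p : Eulerian) (ξ : ℝ) : p.char ξ ≤ ξ :=
  (p.le_dist _).trans (p.le_char_iff.1 le_rfl)

theorem sub_le_char (p : Eulerian) (ξ : ℝ) : ξ - p.μ.real Set.univ ≤ p.char ξ :=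
  p.le_char_iff.2 (by linarith [p.dist_le (ξ - p.μ.real Set.univ)])

theorem char_mono (p : Eulerian) : Monotone p.char :=
  fun _ _ h => p.le_char_iff.2 ((p.le_char_iff.1 le_rfl).trans h)

/-- `char` transports Lebesgue measure to `μ + dx`. -/
theorem map_char (p : Eulerian) : (volume : Measure ℝ).map p.char = p.μ + volume := by
  have := p.finite
  have : IsLocallyFiniteMeasure (p.μ + volume) :=
    ⟨fun x => ⟨Set.Ioo (x - 1) (x + 1), Ioo_mem_nhds (by linarith) (by linarith), by
      simp [measure_lt_top]⟩⟩
  symm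
  refine Measure.ext_of_Ico _ _ fun a b hab => ?_
  rw [Measure.map_apply p.char_mono.measurable measurableSet_Ico, Measure.add_apply]
  -- The Galois connection turns half-open intervals into half-open intervals, whatever the atoms of
  -- `μ`.
  have hpre : p.char ⁻¹' Set.Ico a b = Set.Ico (p.dist a) (p.dist b) := by
    ext ξ
    simp only [Set.mem_preimage, Set.mem_Ico, le_char_iff, char_lt_iff]
  have hreal : p.μ.real (Set.Ico a b) = p.μ.real (Set.Iio b) - p.μ.real (Set.Iio a) := by
    rw [show Set.Ico a b = Set.Iio b \ Set.Iio a by ext; simp, measureReal_sdiff (Set.Iio_subset_Iio hab.le) measurableSet_Iio]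
  rw [hpre, Real.volume_Ico, Real.volume_Ico, ← ofReal_measureReal, hreal,
    ← ENNReal.ofReal_add (by
      rw [← hreal]; exact measureReal_nonneg) (by linarith)]
  congr 1
  simp only [dist]
  ring

theorem integrable_comp_char (p : Eulerian) {φ : ℝ → ℝ} (hφ : Continuous φ)
    (hc : HasCompactSupport φ) : Integrable (fun ξ => φ (p.char ξ)) volume := by
  have := p.finite
  have h : Integrable φ (volume.map p.char) := by
    rw [p.map_char]
    exact (hφ.integrable_of_hasCompactSupport hc).add_measure
      (hφ.integrable_of_hasCompactSupport hc)
  exact (integrable_map_measure hφ.aestronglyMeasurable p.char_mono.measurable.aemeasurable).1 h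

theorem integral_comp_char (p : Eulerian) {φ : ℝ → ℝ} (hφ : Continuous φ)
    (hc : HasCompactSupport φ) : ∫ ξ, φ (p.char ξ) = ∫ x, φ x ∂p.μ + ∫ x, φ x := by
  have := p.finite
  rw [← integral_add_measure (hφ.integrable_of_hasCompactSupport hc)
      (hφ.integrable_of_hasCompactSupport hc), ← p.map_char,
    integral_map p.char_mono.measurable.aemeasurable hφ.aestronglyMeasurable]

/-- The total mass is bounded by any bound for `ξ - y(ξ)`. -/
theorem measureReal_univ_le (p : Eulerian) {M : ℝ} (h : ∀ ξ, ξ - p.char ξ ≤ M) :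
    p.μ.real Set.univ ≤ M := by
  have := p.finite
  have hU : ⋃ n : ℕ, Set.Iio (n : ℝ) = Set.univ := by
    ext x
    simpa using exists_nat_gt x
  have h1 : Tendsto (fun n : ℕ => p.μ.real (Set.Iio (n : ℝ))) atTop (𝓝 (p.μ.real Set.univ)) := by
    have := tendsto_measure_iUnion_atTop (μ := p.μ) (s := fun n : ℕ => Set.Iio (n : ℝ))
      (fun m n hmn => Set.Iio_subset_Iio (by exact_mod_cast hmn))
    rw [hU] at this
    exact (ENNReal.tendsto_toReal (measure_ne_top _ _)).comp this
  refine le_of_tendsto' h1 fun n => ?_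
  -- At `ξ = dist n` the difference `ξ - y(ξ)` is exactly `μ((-∞, n))`.
  have := h (p.dist n)
  rw [char_dist] at this
  simpa [dist] using this

end Eulerian

/-! ### Convergence in Eulerian variables -/

theorem MemH1.uniformContinuous {f : ℝ → ℝ} (h : MemH1 f) : UniformContinuous f := by
  have hH : HolderWith (eLpNorm (weakDeriv f) 2 volume).toNNReal (1 / 2) f := by
    intro a b
    rw [edist_eq_enorm_sub, ENNReal.coe_toNNReal h.2.2.2.eLpNorm_ne_top]
    refine (h.2.2.1.hasWeakDeriv.enorm_sub_le h.1 b a).trans (le_of_eq ?_)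
    rw [edist_dist, Real.dist_eq]
    norm_num
  exact hH.uniformContinuous (by norm_num)

namespace Eulerian

variable {p : ℕ → Eulerian} {q : Eulerian}

theorem tendstoUniformly_L (h : Tendsto (fun n => (p n).dD q) atTop (𝓝 0)) :
    TendstoUniformly (fun n => (p n).char) q.char atTop ∧
      TendstoUniformly (fun n => (p n).u ∘ (p n).char) (q.u ∘ q.char) atTop := by
  have h2 : Tendsto (fun n => 2 * (p n).dD q) atTop (𝓝 0) := by
    simpa using ENNReal.Tendsto.const_mul h (Or.inr (by simp))
  constructor
  · rw [EMetric.tendstoUniformly_iff]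
    intro ε hε
    filter_upwards [(tendsto_order.1 h2).2 ε hε] with n hn ξ
    rw [edist_comm]
    exact ((Lagrangian.edist_le_d (p n).L q.L ξ).1).trans_lt hn
  · rw [EMetric.tendstoUniformly_iff]
    intro ε hε
    filter_upwards [(tendsto_order.1 h2).2 ε hε] with n hn ξ
    rw [edist_comm]
    exact ((Lagrangian.edist_le_d (p n).L q.L ξ).2).trans_lt hn

/-- Writing `x = y_n(ξ)`, compare `u_n(x) = U_n(ξ)` with `U(ξ) = u(y(ξ))`, then with `u(y_n(ξ))`.
Only the limit `u` needs a modulus of continuity. -/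
theorem tendstoUniformly_u (hy : TendstoUniformly (fun n => (p n).char) q.char atTop)
    (hU : TendstoUniformly (fun n => (p n).u ∘ (p n).char) (q.u ∘ q.char) atTop) :
    TendstoUniformly (fun n => (p n).u) q.u atTop := by
  have hc := q.u_mem.uniformContinuous.comp_tendstoUniformly hy
  rw [Metric.tendstoUniformly_iff] at hc hU ⊢
  intro ε hε
  filter_upwards [hc (ε / 2) (half_pos hε), hU (ε / 2) (half_pos hε)] with n h1 h2 x
  obtain ⟨ξ, rfl⟩ := (p n).char_surjective x
  have := dist_triangle_left (q.u ((p n).char ξ)) ((p n).u ((p n).char ξ)) (q.u (q.char ξ))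
  have h1 := h1 ξ
  have h2 := h2 ξ
  simp only [Function.comp_apply] at h1 h2
  linarith

theorem tendsto_eLpNorm_top {f : ℕ → ℝ → ℝ} {g : ℝ → ℝ} (h : TendstoUniformly f g atTop) :
    Tendsto (fun n => eLpNorm (f n - g) ⊤ volume) atTop (𝓝 0) := by
  rw [ENNReal.tendsto_nhds_zero]
  rw [EMetric.tendstoUniformly_iff] at h
  intro ε hε
  filter_upwards [h ε hε] with n hn
  rw [eLpNorm_exponent_top]
  refine eLpNormEssSup_le_of_ae_enorm_bound (Eventually.of_forall fun x => ?_)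
  rw [Pi.sub_apply, ← edist_eq_enorm_sub, edist_comm]
  exact (hn x).le

theorem tendsto_integral_of_hasCompactSupport
    (hy : TendstoUniformly (fun n => (p n).char) q.char atTop)
    {φ : ℝ → ℝ} (hφ : Continuous φ) (hc : HasCompactSupport φ) :
    Tendsto (fun n => ∫ x, φ x ∂(p n).μ) atTop (𝓝 (∫ x, φ x ∂q.μ)) := by
  suffices h : Tendsto (fun n => ∫ ξ, φ ((p n).char ξ)) atTop (𝓝 (∫ ξ, φ (q.char ξ))) by
    simp only [integral_comp_char _ hφ hc] at h
    simpa using h.sub_const (∫ x, φ x)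
  obtain ⟨M, hM⟩ := hc.exists_bound_of_continuous hφ
  obtain ⟨R, hR⟩ := hc.isCompact.isBounded.subset_closedBall 0
  set m := q.μ.real Set.univ
  -- On the support `|y_n| ≤ R`; eventually `|y_n - y| < 1`, and `0 ≤ ξ - y ≤ m`. So `|ξ| ≤ R + 1 +
  -- m` there.
  refine tendsto_integral_filter_of_dominated_convergence
    ((Set.Icc (-(R + 1 + m)) (R + 1 + m)).indicator fun _ => M) ?_ ?_ ?_ ?_
  · exact Eventually.of_forall fun n => ((p n).integrable_comp_char hφ hc).aestronglyMeasurable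
  · filter_upwards [Metric.tendstoUniformly_iff.1 hy 1 one_pos] with n hn
    refine Eventually.of_forall fun ξ => ?_
    by_cases hξ : ξ ∈ Set.Icc (-(R + 1 + m)) (R + 1 + m)
    · rw [Set.indicator_of_mem hξ]
      exact hM _
    · rw [Set.indicator_of_notMem hξ, norm_le_zero_iff]
      by_contra hne
      have h1 := hR (subset_tsupport _ (Function.mem_support.2 hne))
      rw [mem_closedBall_zero_iff, Real.norm_eq_abs, abs_le] at h1
      have h2 := hn ξ
      rw [Real.dist_eq, abs_lt] at h2
      have h3 := q.char_le ξ
      have h4 := q.sub_le_char ξ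
      have hm : 0 ≤ m := measureReal_nonneg
      exact hξ ⟨by linarith [h1.1, h2.1, h2.2], by linarith [h1.2, h2.1, h2.2]⟩
  · exact (integrable_indicator_iff measurableSet_Icc).2 (by simp [integrableOn_const_iff])
  · refine Eventually.of_forall fun ξ => ?_
    exact (hφ.tendsto _).comp (hy.tendsto_at ξ)

/-- A `C₀` function is uniformly close to a compactly supported one. -/
theorem exists_hasCompactSupport_near (φ : C₀(ℝ, ℝ)) {ε : ℝ} (hε : 0 < ε) :
    ∃ ψ : ℝ → ℝ, Continuous ψ ∧ HasCompactSupport ψ ∧ ∀ x, |φ x - ψ x| ≤ ε := by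
  -- Subtracting the truncation of `φ` to `[-ε, ε]` costs at most `ε` and leaves 0 wherever `|φ| <
  -- ε`.
  refine ⟨fun x => φ x - max (-ε) (min (φ x) ε), ?_, ?_, fun x => ?_⟩
  · have := φ.continuous
    fun_prop
  · rw [hasCompactSupport_iff_eventuallyEq, coclosedCompact_eq_cocompact]
    filter_upwards [Metric.tendsto_nhds.1 φ.zero_at_infty' ε hε] with x hx
    have hx : |φ x| < ε := by simpa using hx
    rw [abs_lt] at hx
    rw [min_eq_left hx.2.le, max_eq_right hx.1.le, sub_self, Pi.zero_apply]
  · rw [sub_sub_cancel, abs_le]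
    exact ⟨le_max_left _ _, max_le (by linarith) (min_le_right _ _)⟩

theorem tendsto_integral_zeroAtInfty
    (hy : TendstoUniformly (fun n => (p n).char) q.char atTop) (φ : C₀(ℝ, ℝ)) :
    Tendsto (fun n => ∫ x, φ x ∂(p n).μ) atTop (𝓝 (∫ x, φ x ∂q.μ)) := by
  have hm : 0 ≤ q.μ.real Set.univ := measureReal_nonneg
  set K := q.μ.real Set.univ + 1
  rw [Metric.tendsto_nhds]
  intro η hη
  have hK0 : 0 < K := by linarith
  -- Error budget: `η / 4` for replacing `φ` by `ψ` under each of the two measures, `η / 2` for the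
  -- convergence with `ψ`.
  have hε : 0 < η / (4 * K) := by positivity
  obtain ⟨ψ, hψ, hψc, hφψ⟩ := exists_hasCompactSupport_near φ hε
  have key : ∀ r : Eulerian, r.μ.real Set.univ ≤ K → |∫ x, φ x ∂r.μ - ∫ x, ψ x ∂r.μ| ≤ η / 4 := by
    intro r hr
    have := r.finite
    have hφi : Integrable φ r.μ := BoundedContinuousFunction.integrable r.μ φ.toBCF
    rw [← integral_sub hφi (hψ.integrable_of_hasCompactSupport hψc), ← Real.norm_eq_abs]
    refine (norm_integral_le_of_norm_le_const (Eventually.of_forall hφψ)).trans ?_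
    calc η / (4 * K) * r.μ.real Set.univ ≤ η / (4 * K) * K := by gcongr
      _ = η / 4 := by field_simp
  filter_upwards [Metric.tendstoUniformly_iff.1 hy 1 one_pos,
    Metric.tendsto_nhds.1 (tendsto_integral_of_hasCompactSupport hy hψ hψc) (η / 2)
      (half_pos hη)] with n hn hnψ
  -- Uniform closeness of `y_n` to `y` within 1 raises the bound on `ξ - y`, hence on the mass, by
  -- at most 1.
  have hmass : (p n).μ.real Set.univ ≤ K := by
    refine (p n).measureReal_univ_le fun ξ => ?_
    have h2 := hn ξ
    rw [Real.dist_eq, abs_lt] at h2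
    linarith [q.sub_le_char ξ, h2.2]
  have h1 := abs_le.1 (key (p n) hmass)
  have h2 := abs_le.1 (key q (by linarith))
  rw [Real.dist_eq, abs_lt] at hnψ ⊢
  constructor <;> linarith [h1.1, h1.2, h2.1, h2.2, hnψ.1, hnψ.2]

end Eulerian

end CamassaHolm

theorem mainTheorem6 (p : ℕ → CamassaHolm.Eulerian) (q : CamassaHolm.Eulerian)
    (h : Tendsto (fun n => (p n).dD q) atTop (𝓝 0)) :
    (TendstoUniformly (fun n => (p n).u) q.u atTop ∧
      Tendsto (fun n => eLpNorm ((p n).u - q.u) ⊤ volume) atTop (𝓝 0)) ∧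
    ∀ φ : C₀(ℝ, ℝ), Tendsto (fun n => ∫ x, φ x ∂(p n).μ) atTop (𝓝 (∫ x, φ x ∂q.μ)) := by
  obtain ⟨hy, hU⟩ := CamassaHolm.Eulerian.tendstoUniformly_L h
  have hu := CamassaHolm.Eulerian.tendstoUniformly_u hy hU
  exact ⟨⟨hu, CamassaHolm.Eulerian.tendsto_eLpNorm_top hu⟩,
    CamassaHolm.Eulerian.tendsto_integral_zeroAtInfty hy⟩
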